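/- Let $X$ be a Tychonoff (completely regular Hausdorff) topological space, and let $C_k(X)$ be the real locally convex space of all continuous functions $X\to\mathbb R$ with the compact-open topology. The following are equivalent: 1. $C_k(X)$ is tame; 2. $C_k(X)$ is a Namioka--Phelps (NP) space; 3. every compact subset of $X$ is scattered (that is, each of its nonempty subsets $A$ has a point isolated in $A$). Here, for a real locally convex space $E$, let $\mathrm{eqc}(E^*)$ be the system of all weak-star compact equicontinuous subsets of the dual $E^*$. A sequence of functions $f_n\colon K\to\mathbb R$ is independent if there are reals $a<b$ such that for all finite disjoint $P,M\subseteq\mathbb N$ there is $x\in K$ with $f_n(x)<a$ for all $n\in P$ and $f_n(x)>b$ for all $n\in M$. The space $E$ is tame if for every bounded $B\subseteq E$ and every $K\in\mathrm{eqc}(E^*)$ the family $B$, viewed as a (necessarily bounded) family of functions on $K$, contains no independent sequence. The space $E$ is NP if every $K\in\mathrm{eqc}(E^*)$ is (weak-star, strong)-fragmented, i.e. for every nonempty $A\subseteq K$, every bounded $B\subseteq E$ and every $\varepsilon>0$ there is a weak-star open $O\subseteq E^*$ such that $O\cap A\neq\emptyset$ and $|\varphi(v)-\psi(v)|<\varepsilon$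 for all $\varphi,\psi\in O\cap A$ and all $v\in B$. -/

import Mathlib

open Topology Uniformity

/-- A sequence of real functions on a set `X` is (combinatorially) independent if there are reals
`a < b` such that for all finite disjoint `P, M ⊆ ℕ` some point `x` satisfies `f n x < a` for all
`n ∈ P` and `b < f n x` for all `n ∈ M`. -/
def IsIndependentSeq {X : Type*} (f : ℕ → X → ℝ) : Prop :=
  ∃ a b : ℝ, a < b ∧ ∀ P M : Finset ℕ, Disjoint P M →
    ∃ x : X, (∀ n ∈ P, f n x < a) ∧ (∀ n ∈ M, b < f n x)

/-- A tame family: a (uniformly) bounded family of real functions on `X` which contains no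
independent sequence. -/
def IsTameFamily {X : Type*} (F : Set (X → ℝ)) : Prop :=
  (∃ C : ℝ, ∀ f ∈ F, ∀ x : X, |f x| ≤ C) ∧
    ¬ ∃ f : ℕ → X → ℝ, (∀ n, f n ∈ F) ∧ IsIndependentSeq f

/-- A (not necessarily continuous) function from a topological space to a uniform space is
fragmented if every nonempty `A ⊆ X` has, for every entourage `V`, a nonempty relatively open
piece whose image is `V`-small. -/
def IsFragmentedMap {X Y : Type*} [TopologicalSpace X] [UniformSpace Y] (f : X → Y) : Prop :=
  ∀ A : Set X, A.Nonempty → ∀ V ∈ 𝓤 Y, ∃ O : Set X, IsOpen O ∧ (O ∩ A).Nonempty ∧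
    ∀ x ∈ O ∩ A, ∀ y ∈ O ∩ A, (f x, f y) ∈ V

section LocallyConvex

variable (E : Type*) [AddCommGroup E] [Module ℝ E] [TopologicalSpace E]
  [IsTopologicalAddGroup E] [ContinuousSMul ℝ E]

/-- `eqc(E*)`: the system of all weak-star compact equicontinuous subsets of the dual. -/
def eqcDual : Set (Set (WeakDual ℝ E)) :=
  {K | IsCompact K ∧ Equicontinuous (fun (φ : K) (v : E) => φ.1 v)}

variable {E}

/-- The vectors in `B ⊆ E`, regarded as functions on the set `K` of functionals. -/
def evalFamily (B : Set E) (K : Set (WeakDual ℝ E)) : Set (K → ℝ) :=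
  (fun (v : E) (φ : K) => φ.1 v) '' B

variable (E)

/-- A locally convex space is tame if every bounded subset is a tame family on every
weak-star compact equicontinuous subset of the dual. -/
def IsTameLCS [LocallyConvexSpace ℝ E] : Prop :=
  ∀ B : Set E, Bornology.IsVonNBounded ℝ B → ∀ K ∈ eqcDual E, IsTameFamily (evalFamily B K)

/-- A locally convex space is Namioka-Phelps if every weak-star compact equicontinuous subset `K`
of the dual is (weak-star, strong)-fragmented. The uniformity on `StrongDual ℝ E` is that of
uniform convergence on bounded subsets of `E`; the topology on `K` is the weak-star one. -/
def IsNamiokaPhelps [LocallyConvexSpace ℝ E] : Prop :=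
  ∀ K ∈ eqcDual E, IsFragmentedMap (fun φ : K => (WeakDual.toStrongDual φ.1 : StrongDual ℝ E))

end LocallyConvex

/-- A subset `S` of a topological space is scattered (in its subspace topology) if each of its
nonempty subsets `A` has a point isolated in `A`. -/
def IsScatteredSet {X : Type*} [TopologicalSpace X] (S : Set X) : Prop :=
  ∀ A ⊆ S, A.Nonempty → ∃ x ∈ A, ∃ U : Set X, IsOpen U ∧ U ∩ A = {x}

-- NP implies tame: if continuous functions on a compact space are independent, a closed subset maps
-- onto the Cantor cube. On a minimal closed subset with full image, every nonempty relatively open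
-- piece carries two different codes, so some function oscillates there by at least `b - a`, against
-- fragmentation. Tame implies scattered: a nonempty subset of a compact `L` without isolated points
-- supports a dyadic tree of open sets, hence an independent sequence in `[0, 1]`; it is tested on
-- the point evaluations at `L`. Scattered implies NP: an equicontinuous `K` is dominated by a
-- multiple of the sup over a compact `L`. Zorn gives a maximal open `U` such that the unit ball
-- functions supported in `U` fragment `K`. Chains pass by `isFragmentedBy_unitBallOn_sUnion`; a
-- point isolated in `L \ U` would enlarge `U` by `IsFragmentedBy.unitBallOn_union`.

universe u

/-! ### Independence against fragmentation on compact spaces -/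

/-- Independent continuous functions on a compact space are not fragmented: the witness is a
minimal closed set which is mapped onto the Cantor set. -/
theorem exists_nonempty_forall_isOpen_of_isIndependentSeq {K : Type u} [TopologicalSpace K]
    [CompactSpace K] {g : ℕ → K → ℝ} (hg : ∀ n, Continuous (g n)) (hind : IsIndependentSeq g) :
    ∃ δ > 0, ∃ A : Set K, A.Nonempty ∧ ∀ O : Set K, IsOpen O → (O ∩ A).Nonempty →
      ∃ x ∈ O ∩ A, ∃ y ∈ O ∩ A, ∃ n, δ ≤ |g n x - g n y| := by
  obtain ⟨a, b, hab, hind⟩ := hind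
  have hcl : ∀ n, IsClosed {x | g n x ≤ a} := fun n => isClosed_le (hg n) continuous_const
  have hcl' : ∀ n, IsClosed {x | b ≤ g n x} := fun n => isClosed_le continuous_const (hg n)
  let Z : Set K := ⋂ n, ({x | g n x ≤ a} ∪ {x | b ≤ g n x})
  have hZ : IsClosed Z := isClosed_iInter fun n => (hcl n).union (hcl' n)
  have hZmem : ∀ x : Z, ∀ n, g n x ≤ a ∨ b ≤ g n x := fun x n => Set.mem_iInter.1 x.2 n
  have : CompactSpace Z := isCompact_iff_compactSpace.1 hZ.isCompact
  let q : Z → ℕ → Bool := fun x n => decide (b ≤ g n x)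
  have hq : Continuous q := by
    refine continuous_pi fun n => (continuous_bool_rng true).2 ⟨?_, ?_⟩
    · convert (hcl' n).preimage (continuous_subtype_val (p := (· ∈ Z))) using 1
      ext x; simp [q]
    · convert ((hcl n).preimage (continuous_subtype_val (p := (· ∈ Z)))).isOpen_compl using 1
      ext x
      have := hZmem x n
      simp only [q, Set.mem_preimage, Set.mem_singleton_iff, decide_eq_true_eq, Set.mem_compl_iff,
        Set.mem_ofPred_eq, not_le]
      constructor
      · intro h; linarith
      · intro h; rcases this with h' | h'
        · linarith
        · exact h'
  have hsurj : q.Surjective := by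
    intro σ
    let t : ℕ → Set K := fun n => if σ n then {x | b ≤ g n x} else {x | g n x ≤ a}
    have ht : (⋂ n, t n).Nonempty := by
      refine CompactSpace.iInter_nonempty (fun n => ?_) fun s => ?_
      · by_cases h : σ n
        · simpa [t, h] using hcl' n
        · simpa [t, h] using hcl n
      · obtain ⟨x, hx, hx'⟩ := hind (s.filter fun n => ¬ σ n) (s.filter fun n => σ n)
          (Finset.disjoint_filter_filter_not s s (fun n => σ n = true)).symm
        refine ⟨x, Set.mem_iInter₂.2 fun n hn => ?_⟩
        by_cases h : σ n
        · simpa [t, h] using (hx' n (Finset.mem_filter.2 ⟨hn, h⟩)).le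
        · simpa [t, h] using (hx n (Finset.mem_filter.2 ⟨hn, h⟩)).le
    obtain ⟨x, hx⟩ := ht
    rw [Set.mem_iInter] at hx
    refine ⟨⟨x, Set.mem_iInter.2 fun n => ?_⟩, ?_⟩
    · have := hx n
      by_cases h : σ n
      · right; simpa [t, h] using this
      · left; simpa [t, h] using this
    · funext n
      have := hx n
      by_cases h : σ n
      · simp only [t, h, if_true, Set.mem_ofPred_eq] at this
        simp [q, h, this]
      · simp only [t, h] at this
        have h2 : g n x ≤ a := by simpa using this
        simp only [q, h]
        simp; linarith
  -- `ULift` only moves the Cantor cube into the universe of `K`.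
  obtain ⟨T, hT, himg, hmin⟩ : ∃ T : Set Z, CompactSpace T ∧ q '' T = Set.univ ∧
      ∀ E₀ : Set T, E₀ ≠ Set.univ → IsClosed E₀ → T.domRestrict q '' E₀ ≠ Set.univ := by
    obtain ⟨T, hT, himg, hmin⟩ := exists_compact_surjective_zorn_subset
      (continuous_uliftUp.{0, u}.comp hq) (ULift.up_surjective.{0, u}.comp hsurj)
    refine ⟨T, hT, Set.eq_univ_of_forall fun σ => ?_, fun E₀ h1 h2 h3 => hmin E₀ h1 h2 ?_⟩
    · obtain ⟨x, hx, hxσ⟩ : ULift.up σ ∈ (ULift.up ∘ q) '' T := himg ▸ Set.mem_univ _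
      exact ⟨x, hx, ULift.up_injective hxσ⟩
    · refine Set.eq_univ_of_forall fun ⟨σ⟩ => ?_
      obtain ⟨x, hx, rfl⟩ : σ ∈ T.domRestrict q '' E₀ := h3 ▸ Set.mem_univ σ
      exact ⟨x, hx, rfl⟩
  refine ⟨b - a, sub_pos.2 hab, Subtype.val '' T, ?_, fun O hO hne => ?_⟩
  · have : (q '' T).Nonempty := himg ▸ Set.univ_nonempty
    exact (Set.image_nonempty.1 this).image _
  by_contra! hsmall
  let E₀ : Set T := {x | (x : K) ∉ O}
  have hE₀ : IsClosed E₀ :=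
    (hO.preimage (continuous_subtype_val.comp continuous_subtype_val)).isClosed_compl
  have hE₀' : E₀ ≠ Set.univ := by
    obtain ⟨_, hxO, x, hxT, rfl⟩ := hne
    intro h
    exact (h ▸ Set.mem_univ (⟨x, hxT⟩ : T) : (⟨x, hxT⟩ : T) ∈ E₀) hxO
  have hproper := hmin E₀ hE₀' hE₀
  have hcomp : IsClosed (T.domRestrict q '' E₀) :=
    (hE₀.isCompact.image (hq.comp continuous_subtype_val)).isClosed
  obtain ⟨σ, hσ⟩ := (Set.ne_univ_iff_exists_notMem _).1 hproper
  -- Codes missed by `E₀` come from points of `O`, where oscillation below `b - a` forces a single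
  -- code. So `{σ}` is the complement of a closed set, but the Cantor cube has no isolated point.
  have hconst : ∀ τ, τ ∉ T.domRestrict q '' E₀ → τ = σ := by
    have key : ∀ τ, τ ∉ T.domRestrict q '' E₀ → ∃ x : Z, x ∈ T ∧ (x : K) ∈ O ∧ q x = τ := by
      intro τ hτ
      obtain ⟨x, hxT, rfl⟩ : τ ∈ q '' T := himg ▸ Set.mem_univ τ
      refine ⟨x, hxT, ?_, rfl⟩
      by_contra hxO
      exact hτ ⟨⟨x, hxT⟩, hxO, rfl⟩
    intro τ hτ
    obtain ⟨x, hxT, hxO, rfl⟩ := key τ hτ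
    obtain ⟨y, hyT, hyO, rfl⟩ := key σ hσ
    funext n
    have h := abs_lt.1 (hsmall x ⟨hxO, x, hxT, rfl⟩ y ⟨hyO, y, hyT, rfl⟩ n)
    have hx := hZmem x n
    have hy := hZmem y n
    simp only [q, decide_eq_decide]
    constructor
    · intro h1; rcases hy with h2 | h2
      · linarith
      · exact h2
    · intro h1; rcases hx with h2 | h2
      · linarith
      · exact h2
  have hopen : IsOpen ({σ} : Set (ℕ → Bool)) := by
    convert hcomp.isOpen_compl using 1
    ext τ
    exact ⟨fun h => h ▸ hσ, fun h => hconst τ h⟩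
  obtain ⟨I, u, hu, hsub⟩ := isOpen_pi_iff.1 hopen σ rfl
  obtain ⟨m, hm⟩ := Infinite.exists_notMem_finset I
  have : Function.update σ m (!σ m) = σ := hsub fun i hi => by
    rw [Function.update_of_ne (by rintro rfl; exact hm hi)]
    exact (hu i hi).2
  have := congrFun this m
  simp at this

/-! ### Equicontinuous sets in the dual; NP implies tame -/

section LocallyConvex

variable {E : Type*} [AddCommGroup E] [Module ℝ E] [TopologicalSpace E]

theorem StrongDual.hasBasis_uniformity :
    (𝓤 (StrongDual ℝ E)).HasBasis (fun p : Set E × ℝ => Bornology.IsVonNBounded ℝ p.1 ∧ 0 < p.2)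
      fun p => {q | ∀ v ∈ p.1, |q.1 v - q.2 v| < p.2} := by
  rw [uniformity_eq_comap_nhds_zero_swapped]
  refine ((ContinuousLinearMap.hasBasis_nhds_zero_of_basis
    (Metric.nhds_basis_ball (x := (0 : ℝ)))).comap _).congr (fun _ => Iff.rfl) fun p _ => ?_
  ext q
  simp

theorem Bornology.IsVonNBounded.exists_inv_smul_mem {B : Set E} (hB : Bornology.IsVonNBounded ℝ B)
    {U : Set E} (hU : U ∈ 𝓝 0) : ∃ c : ℝ, 0 < c ∧ ∀ v ∈ B, c⁻¹ • v ∈ U := by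
  obtain ⟨r, hr, h⟩ := (hB hU).exists_pos
  refine ⟨r, hr, fun v hv => ?_⟩
  exact (Set.mem_smul_set_iff_inv_smul_mem₀ hr.ne' _ _).1 (h r (le_abs_self r) hv)

theorem eventually_abs_lt_one_of_mem_eqcDual {K : Set (WeakDual ℝ E)} (hK : K ∈ eqcDual E) :
    {v : E | ∀ φ ∈ K, |φ v| < 1} ∈ 𝓝 0 := by
  filter_upwards [hK.2 0 _ (Metric.dist_mem_uniformity one_pos)] with v hv φ hφ
  simpa [dist_eq_norm] using hv ⟨φ, hφ⟩

/-- Every nonempty `A ⊆ K` has nonempty weak-star open pieces on which the values at the elements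
of `B` oscillate, uniformly, as little as desired. -/
def IsFragmentedBy (K : Set (WeakDual ℝ E)) (B : Set E) : Prop :=
  ∀ A ⊆ K, A.Nonempty → ∀ ε > 0, ∃ O : Set (WeakDual ℝ E), IsOpen O ∧ (O ∩ A).Nonempty ∧
    ∀ φ ∈ O ∩ A, ∀ ψ ∈ O ∩ A, ∀ v ∈ B, |φ v - ψ v| ≤ ε

theorem IsFragmentedBy.of_smul_mem {K : Set (WeakDual ℝ E)} {B B' : Set E}
    (h : IsFragmentedBy K B) {c : ℝ} (hc : 0 < c) (hB : ∀ v ∈ B', c⁻¹ • v ∈ B) :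
    IsFragmentedBy K B' := by
  intro A hAK hA ε hε
  obtain ⟨O, hO, hne, hsmall⟩ := h A hAK hA (ε / c) (by positivity)
  refine ⟨O, hO, hne, fun φ hφ ψ hψ v hv => ?_⟩
  have := hsmall φ hφ ψ hψ _ (hB v hv)
  rw [map_smul, map_smul, ← smul_sub, smul_eq_mul, abs_mul, abs_inv, abs_of_pos hc,
    inv_mul_le_iff₀ hc, mul_div_cancel₀ _ hc.ne'] at this
  exact this

theorem isFragmentedMap_of_isFragmentedBy {K : Set (WeakDual ℝ E)}
    (h : ∀ B : Set E, Bornology.IsVonNBounded ℝ B → IsFragmentedBy K B) :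
    IsFragmentedMap (fun φ : K => (WeakDual.toStrongDual φ.1 : StrongDual ℝ E)) := by
  intro A hA V hV
  obtain ⟨⟨B, ε⟩, ⟨hB, hε⟩, hsub⟩ := StrongDual.hasBasis_uniformity.mem_iff.1 hV
  obtain ⟨O, hO, ⟨_, hφO, φ, hφA, rfl⟩, hsmall⟩ := h B hB (Subtype.val '' A)
    (by rintro _ ⟨x, _, rfl⟩; exact x.2) (hA.image _) (ε / 2) (half_pos hε)
  refine ⟨Subtype.val ⁻¹' O, hO.preimage continuous_subtype_val, ⟨φ, hφO, hφA⟩, ?_⟩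
  intro x hx y hy
  refine hsub fun v hv => ?_
  exact (hsmall x ⟨hx.1, x, hx.2, rfl⟩ y ⟨hy.1, y, hy.2, rfl⟩ v hv).trans_lt (half_lt_self hε)

theorem exists_abs_le_of_mem_evalFamily {B : Set E} (hB : Bornology.IsVonNBounded ℝ B)
    {K : Set (WeakDual ℝ E)} (hK : K ∈ eqcDual E) :
    ∃ C : ℝ, ∀ f ∈ evalFamily B K, ∀ φ : K, |f φ| ≤ C := by
  obtain ⟨c, hc, h⟩ := hB.exists_inv_smul_mem (eventually_abs_lt_one_of_mem_eqcDual hK)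
  refine ⟨c, ?_⟩
  rintro _ ⟨v, hv, rfl⟩ φ
  have := h v hv φ φ.2
  rw [map_smul, smul_eq_mul, abs_mul, abs_inv, abs_of_pos hc, inv_mul_lt_iff₀ hc] at this
  simpa using this.le

theorem IsNamiokaPhelps.isTameLCS [IsTopologicalAddGroup E] [ContinuousSMul ℝ E]
    [LocallyConvexSpace ℝ E] (h : IsNamiokaPhelps E) : IsTameLCS E := by
  intro B hB K hK
  refine ⟨exists_abs_le_of_mem_evalFamily hB hK, ?_⟩
  rintro ⟨f, hf, hind⟩
  choose v hvB hv using hf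
  have : CompactSpace K := isCompact_iff_compactSpace.1 hK.1
  have hcont : ∀ n, Continuous (f n) := fun n => by
    rw [← hv n]
    exact (WeakDual.eval_continuous (v n)).comp continuous_subtype_val
  obtain ⟨δ, hδ, A, hA, hbig⟩ := exists_nonempty_forall_isOpen_of_isIndependentSeq hcont hind
  obtain ⟨O, hO, hne, hsmall⟩ := h K hK A hA _
    (StrongDual.hasBasis_uniformity.mem_of_mem (i := (B, δ)) ⟨hB, hδ⟩)
  obtain ⟨x, hx, y, hy, n, hn⟩ := hbig O hO hne
  have := hsmall x hx y hy (v n) (hvB n)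
  rw [← hv n] at hn
  exact absurd hn (not_le.2 this)

end LocallyConvex

/-! ### Independent sequences on sets without isolated points -/

section Independent

variable {X : Type*} [TopologicalSpace X]

/-- Multiply functions that vanish at one point of `F` each and equal `1` on `G`. -/
theorem exists_continuousMap_eq_zero_eq_one_of_finset [T35Space X] (F G : Finset X)
    (h : Disjoint F G) : ∃ f : C(X, ℝ), (∀ x, 0 ≤ f x ∧ f x ≤ 1) ∧ (∀ x ∈ F, f x = 0) ∧
      ∀ x ∈ G, f x = 1 := by
  classical
  have h1 : ∀ x : X, ∃ f : X → unitInterval, Continuous f ∧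
      (x ∉ G → f x = 0 ∧ Set.EqOn f 1 (G : Set X)) := by
    intro x
    by_cases hx : x ∈ G
    · exact ⟨1, continuous_const, fun h => absurd hx h⟩
    · obtain ⟨f, hf, hf'⟩ := CompletelyRegularSpace.completely_regular x (G : Set X)
        G.finite_toSet.isClosed (by simpa using hx)
      exact ⟨f, hf, fun _ => hf'⟩
  choose f hf hf' using h1
  have hFG : ∀ x ∈ F, x ∉ G := fun x hx hx' => Finset.disjoint_left.1 h hx hx'
  refine ⟨⟨fun y => ((∏ x ∈ F, f x y : unitInterval) : ℝ), continuous_subtype_val.comp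
    (continuous_finsetProd F fun x _ => hf x)⟩, fun y => (∏ x ∈ F, f x y).2, fun x hx => ?_,
    fun y hy => ?_⟩
  · simp only [ContinuousMap.coe_mk]
    have : ∏ z ∈ F, f z x = 0 := Finset.prod_eq_zero hx (hf' x (hFG x hx)).1
    exact congrArg Subtype.val this
  · simp only [ContinuousMap.coe_mk]
    have : ∏ z ∈ F, f z y = 1 :=
      Finset.prod_eq_one fun x hx => (hf' x (hFG x hx)).2 (Finset.mem_coe.2 hy)
    exact congrArg Subtype.val this

theorem infinite_inter_of_forall_not_isolated [T1Space X] {A : Set X}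
    (hA : ∀ x ∈ A, ∀ U : Set X, IsOpen U → U ∩ A ≠ {x}) {W : Set X} (hW : IsOpen W)
    (hne : (W ∩ A).Nonempty) : (W ∩ A).Infinite := by
  intro hfin
  obtain ⟨x, hxW, hxA⟩ := hne
  refine hA x hxA (W \ ((W ∩ A) \ {x})) (hW.sdiff hfin.sdiff.isClosed) ?_
  ext y
  simp only [Set.mem_inter_iff, Set.mem_sdiff, Set.mem_singleton_iff]
  constructor
  · rintro ⟨⟨h1, h2⟩, h3⟩
    by_contra h
    exact h2 ⟨⟨h1, h3⟩, h⟩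
  · rintro rfl
    exact ⟨⟨hxW, fun h => h.2 rfl⟩, hxA⟩

theorem exists_disjoint_finset_meeting [T1Space X] {A : Set X}
    (hA : ∀ x ∈ A, ∀ U : Set X, IsOpen U → U ∩ A ≠ {x}) (𝒲 : Finset (Set X))
    (h𝒲 : ∀ W ∈ 𝒲, IsOpen W ∧ (W ∩ A).Nonempty) :
    ∃ F G : Finset X, Disjoint F G ∧
      ∀ W ∈ 𝒲, (∃ x ∈ F, x ∈ W ∩ A) ∧ ∃ x ∈ G, x ∈ W ∩ A := by
  classical
  induction 𝒲 using Finset.induction_on with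
  | empty => exact ⟨∅, ∅, by simp, by simp⟩
  | insert W 𝒲 _ ih =>
    obtain ⟨F, G, hFG, hmeet⟩ := ih fun W' hW' => h𝒲 W' (Finset.mem_insert_of_mem hW')
    have hW := h𝒲 W (Finset.mem_insert_self _ _)
    have hinf := infinite_inter_of_forall_not_isolated hA hW.1 hW.2
    obtain ⟨x, hx, hx'⟩ := hinf.exists_notMem_finset (F ∪ G)
    obtain ⟨y, hy, hy'⟩ := hinf.exists_notMem_finset (insert x (F ∪ G))
    refine ⟨insert x F, insert y G, ?_, ?_⟩
    · simp only [Finset.mem_insert, Finset.mem_union, not_or] at hx' hy'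
      simp only [Finset.disjoint_insert_left, Finset.disjoint_insert_right, Finset.mem_insert,
        not_or]
      exact ⟨⟨hy'.1, hy'.2.1⟩, hx'.2, hFG⟩
    · intro W' hW'
      rcases Finset.mem_insert.1 hW' with rfl | hW'
      · exact ⟨⟨x, by simp, hx⟩, ⟨y, by simp, hy⟩⟩
      · obtain ⟨⟨u, hu, hu'⟩, ⟨w, hw, hw'⟩⟩ := hmeet W' hW'
        exact ⟨⟨u, by simp [hu], hu'⟩, ⟨w, by simp [hw], hw'⟩⟩

/-- On a nonempty set without isolated points in a Tychonoff space there is an independent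
sequence of continuous functions into `[0, 1]`. -/
theorem exists_isIndependentSeq_of_forall_not_isolated [T35Space X] {A : Set X} (hne : A.Nonempty)
    (hA : ∀ x ∈ A, ∀ U : Set X, IsOpen U → U ∩ A ≠ {x}) :
    ∃ f : ℕ → C(X, ℝ), (∀ n x, 0 ≤ f n x ∧ f n x ≤ 1) ∧
      IsIndependentSeq fun n (x : A) => f n x := by
  classical
  -- A state is one level of the tree. One function splits all its members at once, and `next` keeps
  -- both halves of each, so level `n` realises every sign pattern of length `n`.
  let S := {𝒲 : Finset (Set X) // ∀ W ∈ 𝒲, IsOpen W ∧ (W ∩ A).Nonempty}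
  let side : C(X, ℝ) → Bool → Set X := fun f i => if i then {x | 3 / 4 < f x} else {x | f x < 1 / 4}
  have hside : ∀ f i, IsOpen (side f i) := by
    rintro f (_ | _)
    · simpa [side] using isOpen_lt f.continuous continuous_const
    · simpa [side] using isOpen_lt continuous_const f.continuous
  have hex : ∀ 𝒲 : S, ∃ f : C(X, ℝ), (∀ x, 0 ≤ f x ∧ f x ≤ 1) ∧
      ∀ W ∈ 𝒲.1, ∀ i, ((W ∩ side f i) ∩ A).Nonempty := by
    rintro ⟨𝒲, h𝒲⟩
    obtain ⟨F, G, hFG, hmeet⟩ := exists_disjoint_finset_meeting hA 𝒲 h𝒲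
    obtain ⟨f, hf, hf0, hf1⟩ := exists_continuousMap_eq_zero_eq_one_of_finset F G hFG
    refine ⟨f, hf, fun W hW i => ?_⟩
    obtain ⟨⟨u, hu, hu'⟩, ⟨w, hw, hw'⟩⟩ := hmeet W hW
    cases i
    · exact ⟨u, ⟨hu'.1, by simp [side, hf0 u hu]⟩, hu'.2⟩
    · exact ⟨w, ⟨hw'.1, by simp [side, hf1 w hw]; norm_num⟩, hw'.2⟩
  choose f hf hf' using hex
  let next : S → S := fun 𝒲 =>
    ⟨(𝒲.1 ×ˢ (Finset.univ : Finset Bool)).image fun p => p.1 ∩ side (f 𝒲) p.2, by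
      intro W hW
      obtain ⟨⟨W', i⟩, hp, rfl⟩ := Finset.mem_image.1 hW
      have hW' := (Finset.mem_product.1 hp).1
      exact ⟨(𝒲.2 W' hW').1.inter (hside _ _), hf' 𝒲 W' hW' i⟩⟩
  let start : S := ⟨{Set.univ}, by simpa using hne⟩
  let s : ℕ → S := fun n => next^[n] start
  have hs : ∀ n, s (n + 1) = next (s n) := fun n => Function.iterate_succ_apply' next n start
  have key : ∀ (σ : ℕ → Bool) (n : ℕ), ∃ W ∈ (s n).1, ∀ i < n, W ⊆ side (f (s i)) (σ i) := by
    intro σ n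
    induction n with
    | zero => exact ⟨Set.univ, by simp [s, start], by simp⟩
    | succ n ih =>
      obtain ⟨W, hW, hsub⟩ := ih
      refine ⟨W ∩ side (f (s n)) (σ n), ?_, fun i hi => ?_⟩
      · rw [hs]
        exact Finset.mem_image.2 ⟨(W, σ n), by simp [hW], rfl⟩
      · rcases Nat.lt_succ_iff_lt_or_eq.1 hi with h | rfl
        · exact Set.inter_subset_left.trans (hsub i h)
        · exact Set.inter_subset_right
  refine ⟨fun n => f (s n), fun n => hf (s n), 1 / 4, 3 / 4, by norm_num, fun P M hPM => ?_⟩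
  obtain ⟨N, hN⟩ := (P ∪ M).exists_nat_subset_range
  obtain ⟨W, hW, hsub⟩ := key (fun i => decide (i ∈ M)) N
  obtain ⟨x, hxW, hxA⟩ := ((s N).2 W hW).2
  refine ⟨⟨x, hxA⟩, fun n hn => ?_, fun n hn => ?_⟩
  · have := hsub n (Finset.mem_range.1 (hN (Finset.mem_union_left _ hn))) hxW
    simpa [side, Finset.disjoint_left.1 hPM hn] using this
  · have := hsub n (Finset.mem_range.1 (hN (Finset.mem_union_right _ hn))) hxW
    simpa [side, hn] using this

end Independent

/-! ### Fragmentation over scattered compact sets -/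

section ContinuousMap

variable {X : Type*} [TopologicalSpace X]

theorem ContinuousMap.hasBasis_nhds_abs_sub_lt (f : C(X, ℝ)) :
    (𝓝 f).HasBasis (fun p : Set X × ℝ => IsCompact p.1 ∧ 0 < p.2)
      fun p => {g | ∀ x ∈ p.1, |g x - f x| < p.2} := by
  refine (nhds_basis_uniformity' (Metric.uniformity_basis_dist (α := ℝ)
    ).compactConvergenceUniformity).congr (fun _ => Iff.rfl) fun p _ => ?_
  ext g
  simp [UniformSpace.ball, Real.dist_eq, abs_sub_comm]

/-- The unit ball of `C(L, ℝ)`, restricted to the functions whose restriction to `L` vanishes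
outside `U`. -/
def unitBallOn (L U : Set X) : Set C(X, ℝ) :=
  {f | (∀ x ∈ L, |f x| ≤ 1) ∧ ∀ x ∈ L, x ∉ U → f x = 0}

variable {K : Set (WeakDual ℝ C(X, ℝ))} {L : Set X} {M : ℝ}

theorem exists_isCompact_bound_of_mem_eqcDual (hK : K ∈ eqcDual C(X, ℝ)) :
    ∃ L : Set X, IsCompact L ∧ ∃ M > 0, ∀ φ ∈ K, ∀ f : C(X, ℝ), ∀ c > 0,
      (∀ x ∈ L, |f x| ≤ c) → |φ f| ≤ M * c := by
  obtain ⟨⟨L, δ⟩, ⟨hL, hδ⟩, hsub⟩ := (ContinuousMap.hasBasis_nhds_abs_sub_lt 0).mem_iff.1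
    (eventually_abs_lt_one_of_mem_eqcDual hK)
  refine ⟨L, hL, 2 / δ, by positivity, fun φ hφ f c hc hf => ?_⟩
  -- The factor `2` turns the bound `≤ c` into the strict bound `< δ`.
  have hmem : (δ / (2 * c)) • f ∈ {v : C(X, ℝ) | ∀ φ ∈ K, |φ v| < 1} := by
    refine hsub fun x hx => ?_
    have h1 : |δ / (2 * c)| = δ / (2 * c) := abs_of_pos (by positivity)
    have h2 := hf x hx
    simp only [ContinuousMap.smul_apply, ContinuousMap.zero_apply, sub_zero, smul_eq_mul, abs_mul,
      h1]
    calc δ / (2 * c) * |f x| ≤ δ / (2 * c) * c := by gcongr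
      _ = δ / 2 := by field_simp
      _ < δ := half_lt_self hδ
  have := hmem φ hφ
  rw [map_smul, smul_eq_mul, abs_mul, abs_of_pos (by positivity : 0 < δ / (2 * c))] at this
  calc |φ f| = (2 * c / δ) * (δ / (2 * c) * |φ f|) := by field_simp
    _ ≤ (2 * c / δ) * 1 := by gcongr
    _ = 2 / δ * c := by ring

/-- Functions vanishing on `L` satisfy the bound for every `c > 0`, so `K` is small on them without
any cutting. -/
theorem isFragmentedBy_unitBallOn_empty
    (hM : ∀ φ ∈ K, ∀ f : C(X, ℝ), ∀ c > 0, (∀ x ∈ L, |f x| ≤ c) → |φ f| ≤ M * c) (hM0 : 0 < M) :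
    IsFragmentedBy K (unitBallOn L ∅) := by
  intro A hAK hA ε hε
  refine ⟨Set.univ, isOpen_univ, by simpa using hA, fun φ hφ ψ hψ f hf => ?_⟩
  have h : ∀ χ ∈ K, |χ f| ≤ ε / 2 := fun χ hχ => by
    have := hM χ hχ f (ε / (2 * M)) (by positivity) fun x hx => by
      rw [hf.2 x hx (Set.notMem_empty x), abs_zero]; positivity
    refine this.trans_eq ?_
    field_simp
  have h1 := abs_le.1 (h φ (hAK hφ.2))
  have h2 := abs_le.1 (h ψ (hAK hψ.2))
  exact abs_le.2 ⟨by linarith, by linarith⟩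

/-- Subtracting `f x • u` leaves twice an element of the ball over `U`; the remainder lies on the
line of `u`, controlled by one weak-star condition. The budget is `2 * (ε / 4) + ε / 2`. -/
theorem IsFragmentedBy.unitBallOn_union {U V : Set X} (h : IsFragmentedBy K (unitBallOn L U))
    {x : X} (hxL : x ∈ L) {u : C(X, ℝ)} (hu : ∀ y, |u y| ≤ 1) (hux : u x = 1)
    (huV : ∀ y ∉ V, u y = 0) (hV : ∀ y ∈ L, y ∈ V → y ∉ U → y = x) :
    IsFragmentedBy K (unitBallOn L (U ∪ V)) := by
  intro A hAK hA ε hε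
  obtain ⟨O, hO, ⟨φ₀, hφ₀O, hφ₀A⟩, hsmall⟩ := h A hAK hA (ε / 4) (by positivity)
  have hcont : Continuous fun φ : WeakDual ℝ C(X, ℝ) => |φ u - φ₀ u| :=
    ((WeakDual.eval_continuous u).sub continuous_const).abs
  refine ⟨O ∩ {φ | |φ u - φ₀ u| < ε / 4}, hO.inter (isOpen_lt hcont continuous_const),
    ⟨φ₀, ⟨hφ₀O, by simpa using hε⟩, hφ₀A⟩, ?_⟩
  rintro φ ⟨⟨hφO, hφ⟩, hφA⟩ ψ ⟨⟨hψO, hψ⟩, hψA⟩ f hf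
  have hmem : (2⁻¹ : ℝ) • (f - f x • u) ∈ unitBallOn L U := by
    refine ⟨fun y hy => ?_, fun y hy hyU => ?_⟩
    · have h1 : |f x * u y| ≤ 1 := by
        rw [abs_mul]; exact mul_le_one₀ (hf.1 x hxL) (abs_nonneg _) (hu y)
      have h1 := abs_le.1 h1
      have h2 := abs_le.1 (hf.1 y hy)
      simp only [ContinuousMap.smul_apply, ContinuousMap.sub_apply, smul_eq_mul]
      exact abs_le.2 ⟨by linarith, by linarith⟩
    · simp only [ContinuousMap.smul_apply, ContinuousMap.sub_apply, smul_eq_mul]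
      by_cases hyV : y ∈ V
      · rw [hV y hy hyV hyU, hux]; ring
      · rw [huV y hyV, hf.2 y hy (by simp [hyU, hyV])]; ring
  have h1 := abs_le.1 (hsmall φ ⟨hφO, hφA⟩ ψ ⟨hψO, hψA⟩ _ hmem)
  simp only [map_smul, map_sub, smul_eq_mul] at h1
  have h2 : |f x * (φ u - ψ u)| ≤ ε / 2 := by
    rw [abs_mul]
    have h3 : |φ u - ψ u| ≤ ε / 2 := by
      have h4 := abs_lt.1 (show |φ u - φ₀ u| < ε / 4 from hφ)
      have h5 := abs_lt.1 (show |ψ u - φ₀ u| < ε / 4 from hψ)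
      exact abs_le.2 ⟨by linarith, by linarith⟩
    calc |f x| * |φ u - ψ u| ≤ 1 * (ε / 2) := by gcongr; exact hf.1 x hxL
      _ = ε / 2 := one_mul _
  have h2 := abs_le.1 h2
  exact abs_le.2 ⟨by linarith, by linarith⟩

theorem exists_cutoff (f : C(X, ℝ)) {δ : ℝ} (hδ : 0 < δ) : ∃ h : C(X, ℝ),
    (∀ x, 0 ≤ h x ∧ h x ≤ 1) ∧ (∀ x, |f x| < δ → h x = 0) ∧ ∀ x, |f x - f x * h x| ≤ 2 * δ := by
  refine ⟨⟨fun x => max 0 (min 1 (|f x| / δ - 1)), by fun_prop⟩, fun x => ⟨le_max_left _ _,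
    max_le zero_le_one (min_le_left _ _)⟩, fun x hx => ?_, fun x => ?_⟩
  · have : |f x| / δ < 1 := (div_lt_one hδ).2 hx
    exact max_eq_left ((min_le_right _ _).trans (by linarith))
  · simp only [ContinuousMap.coe_mk]
    set t := max 0 (min 1 (|f x| / δ - 1)) with ht
    have h0 : 0 ≤ t := le_max_left _ _
    have h1 : t ≤ 1 := max_le zero_le_one (min_le_left _ _)
    rw [show f x - f x * t = f x * (1 - t) by ring, abs_mul, abs_of_nonneg (by linarith : 0 ≤ 1 - t)]
    by_cases hx : |f x| ≤ 2 * δ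
    · calc |f x| * (1 - t) ≤ 2 * δ * 1 := by gcongr; linarith
        _ = 2 * δ := mul_one _
    · have h2 : 2 ≤ |f x| / δ := (le_div_iff₀ hδ).2 (not_le.1 hx).le
      have h3 : t = 1 := by
        rw [ht, min_eq_left (by linarith), max_eq_right zero_le_one]
      rw [h3]; simp; exact hδ.le

/-- Cut `A` to the slice where some `f` almost attains the supremum over `A` and the ball. Up to a
small error `f` lives on one `V` of the chain by compactness. A functional in the slice has spent
almost all its mass there, so it is small on what the cutoff `h` leaves of any `g`, while `g * h`
belongs to `V`. -/
theorem isFragmentedBy_unitBallOn_sUnion (hL : IsCompact L)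
    (hM : ∀ φ ∈ K, ∀ f : C(X, ℝ), ∀ c > 0, (∀ x ∈ L, |f x| ≤ c) → |φ f| ≤ M * c) (hM0 : 0 < M)
    {𝒰 : Set (Set X)} (hne : 𝒰.Nonempty) (hchain : IsChain (· ⊆ ·) 𝒰)
    (h𝒰 : ∀ U ∈ 𝒰, IsOpen U ∧ IsFragmentedBy K (unitBallOn L U)) :
    IsFragmentedBy K (unitBallOn L (⋃₀ 𝒰)) := by
  intro A hAK hA ε hε
  set η := ε / 8 with hη
  have hη0 : 0 < η := by positivity
  let T : Set ℝ := {r | ∃ φ ∈ A, ∃ f ∈ unitBallOn L (⋃₀ 𝒰), r = φ f}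
  have hT : BddAbove T := by
    refine ⟨M * 1, ?_⟩
    rintro _ ⟨φ, hφ, f, hf, rfl⟩
    exact (le_abs_self _).trans (hM φ (hAK hφ) f 1 one_pos hf.1)
  have hTne : T.Nonempty := by
    obtain ⟨φ, hφ⟩ := hA
    exact ⟨_, φ, hφ, 0, ⟨by simp, by simp⟩, rfl⟩
  have hle : ∀ φ ∈ A, ∀ f ∈ unitBallOn L (⋃₀ 𝒰), φ f ≤ sSup T := fun φ hφ f hf =>
    le_csSup hT ⟨φ, hφ, f, hf, rfl⟩
  obtain ⟨_, ⟨φ₀, hφ₀, f, hf, rfl⟩, hlt⟩ := exists_lt_of_lt_csSup hTne (sub_lt_self (sSup T) hη0)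
  have hδ : 0 < η / (2 * M) := by positivity
  obtain ⟨h, hh, hh0, hfh⟩ := exists_cutoff f hδ
  obtain ⟨V, hV𝒰, hV⟩ : ∃ V ∈ 𝒰, L ∩ {x | η / (2 * M) ≤ |f x|} ⊆ V := by
    have hcomp : IsCompact (L ∩ {x | η / (2 * M) ≤ |f x|}) :=
      hL.inter_right (isClosed_le continuous_const f.continuous.abs)
    have := hne.to_subtype
    obtain ⟨V, hV⟩ := hcomp.elim_directed_cover (fun U : 𝒰 => (U : Set X))
      (fun U => (h𝒰 U U.2).1) (fun x hx => by
        rw [← Set.sUnion_eq_iUnion]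
        by_contra hxU
        have : η / (2 * M) ≤ |f x| := hx.2
        rw [hf.2 x hx.1 hxU, abs_zero] at this
        linarith) hchain.directedOn.directed_val
    exact ⟨V, V.2, hV⟩
  have hopen : IsOpen {φ : WeakDual ℝ C(X, ℝ) | sSup T - η < φ f} :=
    isOpen_lt continuous_const (WeakDual.eval_continuous f)
  obtain ⟨O, hO, ⟨φ₁, hφ₁O, hφ₁A, hφ₁⟩, hsmall⟩ := (h𝒰 V hV𝒰).2 (A ∩ {φ | sSup T - η < φ f})
    (Set.inter_subset_left.trans hAK) ⟨φ₀, hφ₀, hlt⟩ (ε / 2) (half_pos hε)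
  refine ⟨O ∩ {φ | sSup T - η < φ f}, hO.inter hopen, ⟨φ₁, ⟨hφ₁O, hφ₁⟩, hφ₁A⟩, ?_⟩
  rintro φ ⟨⟨hφO, hφ⟩, hφA⟩ ψ ⟨⟨hψO, hψ⟩, hψA⟩ g hg
  have htail : ∀ χ ∈ A, sSup T - η < χ f → |χ (g - g * h)| ≤ 2 * η := by
    intro χ hχ hχf
    -- Convexity: `|f| * h + |g| * (1 - h) ≤ 1`. As `χ (f * h)` is within `2 * η` of the supremum,
    -- both signs of `s` bound the tail.
    have hmem : ∀ s : ℝ, |s| = 1 → f * h + s • (g - g * h) ∈ unitBallOn L (⋃₀ 𝒰) := by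
      intro s hs
      refine ⟨fun x hx => ?_, fun x hx hxU => ?_⟩
      · simp only [ContinuousMap.add_apply, ContinuousMap.mul_apply, ContinuousMap.smul_apply,
          ContinuousMap.sub_apply, smul_eq_mul]
        obtain ⟨h0, h1⟩ := hh x
        calc |f x * h x + s * (g x - g x * h x)|
            ≤ |f x * h x| + |s * (g x - g x * h x)| := abs_add_le _ _
          _ = |f x| * h x + |g x| * (1 - h x) := by
            rw [show g x - g x * h x = g x * (1 - h x) by ring, abs_mul, abs_mul, abs_mul, hs,
              abs_of_nonneg h0, abs_of_nonneg (by linarith : 0 ≤ 1 - h x), one_mul]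
          _ ≤ 1 * h x + 1 * (1 - h x) := by
            have h2 : 0 ≤ 1 - h x := by linarith
            gcongr
            · exact hf.1 x hx
            · exact hg.1 x hx
          _ = 1 := by ring
      · simp [hf.2 x hx hxU, hg.2 x hx hxU]
    have h1 : |χ (f - f * h)| ≤ η := by
      refine (hM χ (hAK hχ) _ (2 * (η / (2 * M))) (by positivity) fun x _ => ?_).trans_eq ?_
      · simpa using hfh x
      · field_simp
    have h1 := abs_le.1 h1
    have h2 := hle χ hχ _ (hmem 1 (by simp))
    have h3 := hle χ hχ _ (hmem (-1) (by simp))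
    simp only [map_add, map_smul, map_sub, smul_eq_mul] at h1 h2 h3 ⊢
    exact abs_le.2 ⟨by linarith, by linarith⟩
  have hgh : g * h ∈ unitBallOn L V := by
    refine ⟨fun x hx => ?_, fun x hx hxV => ?_⟩
    · rw [ContinuousMap.mul_apply, abs_mul]
      exact mul_le_one₀ (hg.1 x hx) (abs_nonneg _) (by rw [abs_of_nonneg (hh x).1]; exact (hh x).2)
    · have : |f x| < η / (2 * M) := not_le.1 fun hle => hxV (hV ⟨hx, hle⟩)
      simp [hh0 x this]
  have h1 := abs_le.1 (hsmall φ ⟨hφO, hφA, hφ⟩ ψ ⟨hψO, hψA, hψ⟩ _ hgh)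
  have h2 := abs_le.1 (htail φ hφA hφ)
  have h3 := abs_le.1 (htail ψ hψA hψ)
  simp only [map_sub] at h2 h3
  -- The two tails and `g * h` add up to `4 * η + ε / 2 = ε`.
  exact abs_le.2 ⟨by linarith, by linarith⟩

theorem IsScatteredSet.isFragmentedBy_unitBallOn [T35Space X] (hLs : IsScatteredSet L)
    (hL : IsCompact L)
    (hM : ∀ φ ∈ K, ∀ f : C(X, ℝ), ∀ c > 0, (∀ x ∈ L, |f x| ≤ c) → |φ f| ≤ M * c) (hM0 : 0 < M) :
    IsFragmentedBy K (unitBallOn L L) := by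
  obtain ⟨U, -, ⟨hU, hUfrag⟩, hmax⟩ := zorn_subset_nonempty
    {U : Set X | IsOpen U ∧ IsFragmentedBy K (unitBallOn L U)}
    (fun 𝒰 h𝒰 hchain hne => ⟨⋃₀ 𝒰, ⟨isOpen_sUnion fun U hU => (h𝒰 hU).1,
      isFragmentedBy_unitBallOn_sUnion hL hM hM0 hne hchain fun U hU => h𝒰 hU⟩,
      fun _ => Set.subset_sUnion_of_mem⟩)
    ∅ ⟨isOpen_empty, isFragmentedBy_unitBallOn_empty hM hM0⟩
  have hLU : L ⊆ U := by
    by_contra hLU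
    obtain ⟨x, ⟨hxL, hxU⟩, V, hV, hVx⟩ := hLs (L \ U) Set.sdiff_subset (Set.sdiff_nonempty.2 hLU)
    have hxV : x ∈ V := ((Set.ext_iff.1 hVx x).2 rfl).1
    obtain ⟨w, hw, hwx, hwV⟩ := CompletelyRegularSpace.completely_regular_isOpen x V hV hxV
    refine hxU (hmax ⟨hU.union hV, hUfrag.unitBallOn_union hxL
      (u := ⟨fun y => 1 - w y, by fun_prop⟩) (fun y => ?_) ?_ (fun y hy => ?_)
      fun y hyL hyV hyU => (Set.ext_iff.1 hVx y).1 ⟨hyV, hyL, hyU⟩⟩ Set.subset_union_left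
      (Or.inr hxV))
    · have := (w y).2
      exact abs_le.2 ⟨by simp; linarith [this.2], by simp; exact this.1⟩
    · simp [hwx]
    · simp [hwV hy]
  intro A hAK hA ε hε
  obtain ⟨O, hO, hne, hsmall⟩ := hUfrag A hAK hA ε hε
  exact ⟨O, hO, hne, fun φ hφ ψ hψ f hf =>
    hsmall φ hφ ψ hψ f ⟨hf.1, fun x hx hxU => absurd (hLU hx) hxU⟩⟩

theorem isNamiokaPhelps_of_forall_isScatteredSet [T35Space X]
    (h : ∀ L : Set X, IsCompact L → IsScatteredSet L) : IsNamiokaPhelps C(X, ℝ) := by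
  intro K hK
  obtain ⟨L, hL, M, hM0, hM⟩ := exists_isCompact_bound_of_mem_eqcDual hK
  refine isFragmentedMap_of_isFragmentedBy fun B hB => ?_
  obtain ⟨c, hc, hcB⟩ := hB.exists_inv_smul_mem
    ((ContinuousMap.hasBasis_nhds_abs_sub_lt 0).mem_of_mem (i := (L, 1)) ⟨hL, one_pos⟩)
  refine ((h L hL).isFragmentedBy_unitBallOn hL hM hM0).of_smul_mem hc fun f hf => ⟨fun x hx => ?_,
    fun x hx hx' => absurd hx hx'⟩
  simpa using (hcB f hf x hx).le

/-! ### Point evaluations; tame implies scattered -/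

theorem image_evalCLM_mem_eqcDual (hL : IsCompact L) :
    (fun x => StrongDual.toWeakDual (ContinuousMap.evalCLM ℝ x : StrongDual ℝ C(X, ℝ))) '' L ∈
      eqcDual C(X, ℝ) := by
  refine ⟨hL.image (WeakDual.continuous_of_continuous_eval fun f => f.continuous), ?_⟩
  intro f V hV
  obtain ⟨ε, hε, hsub⟩ := Metric.mem_uniformity_dist.1 hV
  filter_upwards [(ContinuousMap.hasBasis_nhds_abs_sub_lt f).mem_of_mem (i := (L, ε)) ⟨hL, hε⟩]
    with g hg
  rintro ⟨_, x, hx, rfl⟩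
  refine hsub ?_
  rw [dist_comm, Real.dist_eq]
  exact hg x hx

theorem isVonNBounded_of_forall_abs_le {B : Set C(X, ℝ)} (hB : ∀ f ∈ B, ∀ x, |f x| ≤ 1) :
    Bornology.IsVonNBounded ℝ B := by
  refine (ContinuousMap.hasBasis_nhds_abs_sub_lt 0).isVonNBounded_iff.2 ?_
  rintro ⟨L, δ⟩ ⟨-, hδ⟩
  refine Absorbs.of_norm ⟨2 / δ, fun c hc f hf => ?_⟩
  have hc0 : 0 < |c| := (by positivity : 0 < 2 / δ).trans_le hc
  refine (Set.mem_smul_set_iff_inv_smul_mem₀ (abs_pos.1 hc0) _ _).2 fun x _ => ?_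
  simp only [ContinuousMap.smul_apply, ContinuousMap.zero_apply, sub_zero, smul_eq_mul, abs_mul,
    abs_inv]
  rw [inv_mul_lt_iff₀ hc0]
  have h1 : 2 ≤ |c| * δ := (div_le_iff₀ hδ).1 hc
  linarith [hB f hf x]

theorem IsTameLCS.isScatteredSet [T35Space X] (h : IsTameLCS C(X, ℝ)) (hL : IsCompact L) :
    IsScatteredSet L := by
  intro A hAL hA
  by_contra! hiso
  obtain ⟨f, hf, a, b, hab, hind⟩ := exists_isIndependentSeq_of_forall_not_isolated hA hiso
  refine (h (Set.range f) (isVonNBounded_of_forall_abs_le ?_) _ (image_evalCLM_mem_eqcDual hL)).2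
    ⟨fun n φ => φ.1 (f n), fun n => ⟨f n, ⟨n, rfl⟩, rfl⟩, a, b, hab, fun P M hPM => ?_⟩
  · rintro _ ⟨n, rfl⟩ x
    exact abs_le.2 ⟨by linarith [(hf n x).1], (hf n x).2⟩
  · obtain ⟨x, hx⟩ := hind P M hPM
    exact ⟨⟨_, x, hAL x.2, rfl⟩, hx⟩

end ContinuousMap

theorem propositionp (X : Type*) [TopologicalSpace X] [T35Space X] :
    List.TFAE [IsTameLCS C(X, ℝ), IsNamiokaPhelps C(X, ℝ),
      ∀ K : Set X, IsCompact K → IsScatteredSet K] := by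
  tfae_have 1 → 3 := fun h _ hK => h.isScatteredSet hK
  tfae_have 3 → 2 := isNamiokaPhelps_of_forall_isScatteredSet
  tfae_have 2 → 1 := IsNamiokaPhelps.isTameLCS
  tfae_finish
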